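/- Let $N\ge1$, let $\Omega\subseteq\mathbb{R}^N$ be a nonempty open subset, let $0<m<1$, let $F\in L^1_{\mathrm{loc}}(\Omega;\mathbb{C})$, and let $(a,b)\in\mathbb{C}^2$ satisfy $$\operatorname{Im}(a)\ge0\quad\text{and}\quad\Big(\big(a\ne0\text{ and }\operatorname{Re}(a\overline b)\ge0\big)\ \text{ or }\ \big(a=0\text{ and }b\in\mathbb{B}\big)\Big),$$ where $\mathbb{B}=\big(\mathbb{C}\setminus\{z\in\mathbb{C}:\operatorname{Re}(z)=0\text{ and }\operatorname{Im}(z)\le0\}\big)\cup\{0\}$. Then the Dirichlet problem $$-\mathrm{i}\Delta u+a|u|^{-(1-m)}u+bu=F\ \text{ in }\Omega,\qquad u=0\ \text{ on }\partial\Omega,$$ admits at most one global weak solution $u\in H^1_0(\Omega)\cap L^{m+1}(\Omega)$ (complex-valued functions, identified when equal almost everywhere in $\Omega$). Here $|z|^{-(1-m)}z$ is understood to be $0$ when $z=0$; $H^1_0(\Omega)$ is the closure of $\mathscr{D}(\Omega)=C_c^\infty(\Omega;\mathbb{C})$ in $H^1(\Omega)$; and a global weak solution is a function $u\in H^1_{\mathrm{loc}}(\Omega)$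 which satisfies the equation in $\mathscr{D}'(\Omega)$, that is, $$\operatorname{Re}\int_\Omega(-\mathrm{i}u)\,\overline{\Delta\varphi}\,dx+\operatorname{Re}\int_\Omega\big(a|u|^{-(1-m)}u+bu\big)\overline{\varphi}\,dx=\operatorname{Re}\int_\Omega F\,\overline{\varphi}\,dx\qquad\text{for all }\varphi\in\mathscr{D}(\Omega),$$ and which belongs to $H^1_0(\Omega)\cap L^{m+1}(\Omega)$. -/

import Mathlib

open MeasureTheory TopologicalSpace
open scoped Distributions Laplacian ENNReal

noncomputable section

namespace SublinearSchrodinger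

/-- The set `𝔸 = ℂ \ {z : Re z = 0 and Im z ≤ 0}`. -/
def setA : Set ℂ := {z | ¬ (z.re = 0 ∧ z.im ≤ 0)}

/-- The set `𝔹 = 𝔸 ∪ {0}`. -/
def setB : Set ℂ := setA ∪ {0}

/-- The uniqueness assumption on the pair of complex coefficients `(a, b)`. -/
def UniquenessAssumption (a b : ℂ) : Prop :=
  0 ≤ a.im ∧
    ((a ≠ 0 ∧ 0 ≤ (a * starRingEnd ℂ b).re) ∨ (a = 0 ∧ b ∈ setB))

/-- The nonlinearity `z ↦ |z|^{-(1-m)} z`, with value `0` at `z = 0`. -/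
def nonlinearity (m : ℝ) (z : ℂ) : ℂ := ((‖z‖ ^ (-(1 - m)) : ℝ) : ℂ) * z

variable {N : ℕ}

/-- The classical partial derivative `∂_j f`. -/
def partialDeriv (j : Fin N) (f : EuclideanSpace ℝ (Fin N) → ℂ)
    (x : EuclideanSpace ℝ (Fin N)) : ℂ :=
  fderiv ℝ f x (EuclideanSpace.single j 1)

/-- `g = (g_1, …, g_N)` is the weak (distributional) gradient of `u` on `Ω`: all functions are
locally integrable on `Ω`, and `∫_Ω u ∂_j φ = - ∫_Ω g_j φ` for all `j` and all `φ ∈ 𝓓(Ω)`. -/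
def HasWeakGradient (Ω : Opens (EuclideanSpace ℝ (Fin N)))
    (u : EuclideanSpace ℝ (Fin N) → ℂ) (g : Fin N → EuclideanSpace ℝ (Fin N) → ℂ) : Prop :=
  LocallyIntegrableOn u Ω volume ∧
    ∀ j, LocallyIntegrableOn (g j) Ω volume ∧
      ∀ φ : 𝓓(Ω, ℂ), ∫ x in (Ω : Set (EuclideanSpace ℝ (Fin N))), u x * partialDeriv j φ x
        = - ∫ x in (Ω : Set (EuclideanSpace ℝ (Fin N))), g j x * φ x

/-- The `H¹(Ω)`-norm of a function `u` with weak gradient `g`. -/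
def eH1Norm (Ω : Opens (EuclideanSpace ℝ (Fin N)))
    (u : EuclideanSpace ℝ (Fin N) → ℂ) (g : Fin N → EuclideanSpace ℝ (Fin N) → ℂ) : ℝ≥0∞ :=
  (eLpNorm u 2 (volume.restrict Ω) ^ 2
    + ∑ j, eLpNorm (g j) 2 (volume.restrict Ω) ^ 2) ^ (1 / 2 : ℝ)

/-- `u ∈ H¹_loc(Ω)`: `u` has a weak gradient on `Ω`, and `u` and its weak gradient are square
integrable on every compact subset of `Ω`. -/
def MemH1Loc (Ω : Opens (EuclideanSpace ℝ (Fin N)))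
    (u : EuclideanSpace ℝ (Fin N) → ℂ) : Prop :=
  ∃ g : Fin N → EuclideanSpace ℝ (Fin N) → ℂ, HasWeakGradient Ω u g ∧
    ∀ K : Set (EuclideanSpace ℝ (Fin N)), IsCompact K → K ⊆ Ω →
      MemLp u 2 (volume.restrict K) ∧ ∀ j, MemLp (g j) 2 (volume.restrict K)

/-- `u ∈ H¹_0(Ω)`: `u ∈ H¹(Ω)`, and `u` is in the closure of `𝓓(Ω)` for the `H¹(Ω)`-norm. -/
def MemH10 (Ω : Opens (EuclideanSpace ℝ (Fin N)))
    (u : EuclideanSpace ℝ (Fin N) → ℂ) : Prop :=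
  ∃ g : Fin N → EuclideanSpace ℝ (Fin N) → ℂ, HasWeakGradient Ω u g ∧
    MemLp u 2 (volume.restrict Ω) ∧ (∀ j, MemLp (g j) 2 (volume.restrict Ω)) ∧
    ∀ ε : ℝ≥0∞, 0 < ε → ∃ φ : 𝓓(Ω, ℂ),
      eH1Norm Ω (fun x => u x - φ x) (fun j x => g j x - partialDeriv j φ x) < ε

/-- The real duality pairing `Re ∫_Ω T(x) conj(φ(x)) dx`. -/
def pairing (Ω : Opens (EuclideanSpace ℝ (Fin N))) (T φ : EuclideanSpace ℝ (Fin N) → ℂ) : ℝ :=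
  (∫ x in (Ω : Set (EuclideanSpace ℝ (Fin N))), T x * starRingEnd ℂ (φ x)).re

/-- `u` is a local weak solution of `-iΔu + a|u|^{-(1-m)}u + bu = F` in `Ω`: `u ∈ H¹_loc(Ω)` and
the equation holds in `𝓓'(Ω)`, where `⟨-iΔu, φ⟩ = ⟨-iu, Δφ⟩` is the distributional Laplacian. -/
def IsLocalWeakSolution (Ω : Opens (EuclideanSpace ℝ (Fin N))) (m : ℝ) (a b : ℂ)
    (F u : EuclideanSpace ℝ (Fin N) → ℂ) : Prop :=
  MemH1Loc Ω u ∧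
    ∀ φ : 𝓓(Ω, ℂ),
      pairing Ω (fun x => -Complex.I * u x) (Δ (φ : EuclideanSpace ℝ (Fin N) → ℂ))
        + pairing Ω (fun x => a * nonlinearity m (u x) + b * u x) φ
      = pairing Ω F φ

/-- `u` is a global weak solution of `-iΔu + a|u|^{-(1-m)}u + bu = F` in `Ω`, `u = 0` on `∂Ω`:
a local weak solution which lies in `H¹_0(Ω) ∩ L^{m+1}(Ω)`. -/
def IsGlobalWeakSolution (Ω : Opens (EuclideanSpace ℝ (Fin N))) (m : ℝ) (a b : ℂ)
    (F u : EuclideanSpace ℝ (Fin N) → ℂ) : Prop :=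
  IsLocalWeakSolution Ω m a b F u ∧ MemH10 Ω u ∧
    MemLp u (ENNReal.ofReal (m + 1)) (volume.restrict Ω)

end SublinearSchrodinger

end

/-! The proof is an energy argument. Let `w = u₁ - u₂` and let `G` be the difference of the two
nonlinear terms, so that `-iΔw + aG + bw = 0`. Testing with `w` gives `iA + aP + bB = 0`, where `A =
∫|∇w|²`, `B = ∫|w|²` and `P = ∫ G w̄`. If `a ≠ 0`, multiplying by `ā` and taking real parts gives
`Im(a) A + |a|² Re P + Re(a b̄) B = 0`, a sum of nonnegative terms. Hence `Re P = 0`, and strict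
monotonicity of the nonlinearity (`re_nonlinearity_sub_mul_conj_pos`) forces `w = 0`. If `a = 0`,
the real and imaginary parts are `Re(b) B = 0` and `A + Im(b) B = 0`. So `B ≠ 0` is possible only
for `b = 0`, and then the gradient vanishes and so does `w`
(`IsH1Limit.ae_eq_zero_of_grad_ae_eq_zero`). The delicate point is testing with `w`
(`IsH1Limit.energy_identity`): test functions converging to `w` in `H¹` need not converge in
`L^{m+1}`, and `G` need not be in `L²`. With a compactly supported cutoff `ξ` on the whole space,
however, `ξG` is in `L²` by sublinear growth, so `ξw` is admissible. The cutoff is then removed by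
dominated convergence, since `G w̄` is integrable. -/

noncomputable section

namespace SublinearSchrodinger

open Filter Topology ComplexConjugate

/-! ### Growth and strict monotonicity of the nonlinearity. -/

section Nonlinearity

theorem measurable_nonlinearity (m : ℝ) : Measurable (nonlinearity m) := by
  unfold nonlinearity
  fun_prop

theorem norm_nonlinearity {m : ℝ} (hm : m ≠ 0) (z : ℂ) : ‖nonlinearity m z‖ = ‖z‖ ^ m := by
  unfold nonlinearity
  rw [norm_mul, Complex.norm_real, Real.norm_of_nonneg (by positivity)]
  rcases eq_or_ne z 0 with rfl | hz
  · simp [Real.zero_rpow hm]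
  · rw [← Real.rpow_add_one (norm_ne_zero_iff.2 hz)]
    congr 1
    ring

/-- Linear growth is what makes the nonlinear term of an `L²` function square integrable on bounded
sets. -/
theorem norm_nonlinearity_le {m : ℝ} (hm0 : 0 < m) (hm1 : m < 1) (z : ℂ) :
    ‖nonlinearity m z‖ ≤ 1 + ‖z‖ := by
  rw [norm_nonlinearity hm0.ne']
  rcases le_total ‖z‖ 1 with h | h
  · linarith [Real.rpow_le_one (norm_nonneg z) h hm0.le, norm_nonneg z]
  · linarith [Real.rpow_le_self_of_one_le h hm1.le]

/-- Strict monotonicity of the sublinear nonlinearity. -/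
theorem re_nonlinearity_sub_mul_conj_pos {m : ℝ} (hm0 : 0 < m) {z w : ℂ}
    (hzw : z ≠ w) : 0 < ((nonlinearity m z - nonlinearity m w) * conj (z - w)).re := by
  have key : ∀ v : ℂ, ‖v‖ ^ (-(1 - m)) * ‖v‖ = ‖v‖ ^ m := fun v => by
    rw [← norm_nonlinearity hm0.ne' v, nonlinearity, norm_mul, Complex.norm_real,
      Real.norm_of_nonneg (by positivity)]
  have hpos : ∀ v : ℂ, v ≠ 0 → 0 < ‖v‖ ^ (-(1 - m)) := fun v hv =>
    Real.rpow_pos_of_pos (norm_pos_iff.2 hv) _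
  -- Distinct points are not both zero. At the other one it is enough that a real power of a
  -- nonnegative number is nonnegative, whatever its value at zero.
  have hst : 0 < ‖z‖ ^ (-(1 - m)) + ‖w‖ ^ (-(1 - m)) := by
    have h1 : 0 ≤ ‖z‖ ^ (-(1 - m)) := by positivity
    have h2 : 0 ≤ ‖w‖ ^ (-(1 - m)) := by positivity
    rcases eq_or_ne z 0 with rfl | hz
    · linarith [hpos w hzw.symm]
    · linarith [hpos z hz]
  have hmono : 0 ≤ (‖z‖ ^ m - ‖w‖ ^ m) * (‖z‖ - ‖w‖) := by
    rcases le_total ‖z‖ ‖w‖ with h | h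
    · exact mul_nonneg_of_nonpos_of_nonpos
        (sub_nonpos.2 (Real.rpow_le_rpow (norm_nonneg _) h hm0.le)) (sub_nonpos.2 h)
    · exact mul_nonneg (sub_nonneg.2 (Real.rpow_le_rpow (norm_nonneg _) h hm0.le))
        (sub_nonneg.2 h)
  have hmono' : ‖z‖ ≠ ‖w‖ → 0 < (‖z‖ ^ m - ‖w‖ ^ m) * (‖z‖ - ‖w‖) := fun hne => by
    rcases lt_or_gt_of_ne hne with h | h
    · exact mul_pos_of_neg_of_neg
        (sub_neg.2 (Real.rpow_lt_rpow (norm_nonneg _) h hm0)) (sub_neg.2 h)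
    · exact mul_pos (sub_pos.2 (Real.rpow_lt_rpow (norm_nonneg _) h hm0)) (sub_pos.2 h)
  have hc : (z * conj w).re ≤ ‖z‖ * ‖w‖ := by
    simpa using Complex.re_le_norm (z * conj w)
  -- Splitting into a radial and an angular part, both nonnegative: the first is positive when the
  -- moduli differ, the second when they agree but `z ≠ w`.
  have hexp : ((nonlinearity m z - nonlinearity m w) * conj (z - w)).re =
      (‖z‖ ^ m - ‖w‖ ^ m) * (‖z‖ - ‖w‖) +
        (‖z‖ ^ (-(1 - m)) + ‖w‖ ^ (-(1 - m))) * (‖z‖ * ‖w‖ - (z * conj w).re) := by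
    have hz2 : ‖z‖ * ‖z‖ = z.re * z.re + z.im * z.im := by
      rw [← Complex.normSq_apply, Complex.normSq_eq_norm_sq, sq]
    have hw2 : ‖w‖ * ‖w‖ = w.re * w.re + w.im * w.im := by
      rw [← Complex.normSq_apply, Complex.normSq_eq_norm_sq, sq]
    rw [← key z, ← key w]
    simp only [nonlinearity, Complex.mul_re, Complex.sub_re, Complex.sub_im, Complex.conj_re,
      Complex.conj_im, Complex.mul_im, Complex.ofReal_re, Complex.ofReal_im]
    linear_combination (-‖z‖ ^ (-(1 - m))) * hz2 - ‖w‖ ^ (-(1 - m)) * hw2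
  rw [hexp]
  by_cases hne : ‖z‖ = ‖w‖
  · have hlt : (z * conj w).re < ‖z‖ * ‖w‖ := by
      refine lt_of_le_of_ne hc fun h => hzw ?_
      rw [← sub_eq_zero, ← Complex.normSq_eq_zero, Complex.normSq_sub, h,
        Complex.normSq_eq_norm_sq, Complex.normSq_eq_norm_sq, hne]
      ring
    have := mul_pos hst (sub_pos.2 hlt)
    linarith
  · have := mul_nonneg hst.le (sub_nonneg.2 hc)
    linarith [hmono' hne]

/-- Each factor is at most twice its value at the larger modulus, whence `4 = 2 · 2`. The bound is
integrable when both functions are in `L^{m+1}`. -/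
theorem norm_nonlinearity_sub_mul_le {m : ℝ} (hm0 : 0 < m) (z w : ℂ) :
    ‖(nonlinearity m z - nonlinearity m w) * conj (z - w)‖
      ≤ 4 * (‖z‖ ^ (m + 1) + ‖w‖ ^ (m + 1)) := by
  set M := max ‖z‖ ‖w‖
  have hM : 0 ≤ M := le_max_of_le_left (norm_nonneg z)
  have hp : M ^ m * M = M ^ (m + 1) := by
    rw [Real.rpow_add_one' hM (by linarith)]
  have h1 : ‖nonlinearity m z - nonlinearity m w‖ ≤ 2 * M ^ m := by
    refine (norm_sub_le _ _).trans ?_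
    rw [norm_nonlinearity hm0.ne', norm_nonlinearity hm0.ne', two_mul]
    gcongr
    · exact le_max_left _ _
    · exact le_max_right _ _
  have h2 : ‖conj (z - w)‖ ≤ 2 * M := by
    rw [RCLike.norm_conj]
    refine (norm_sub_le _ _).trans ?_
    rw [two_mul]
    exact add_le_add (le_max_left _ _) (le_max_right _ _)
  have h3 : M ^ (m + 1) ≤ ‖z‖ ^ (m + 1) + ‖w‖ ^ (m + 1) := by
    have hz : 0 ≤ ‖z‖ ^ (m + 1) := by positivity
    have hw : 0 ≤ ‖w‖ ^ (m + 1) := by positivity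
    rcases max_choice ‖z‖ ‖w‖ with h | h <;> simp only [M, h] <;> linarith
  calc _ ≤ (2 * M ^ m) * (2 * M) := by
        rw [norm_mul]; gcongr
    _ = 4 * M ^ (m + 1) := by rw [← hp]; ring
    _ ≤ _ := by linarith

end Nonlinearity

/-! ### Passage to the limit in integrals. -/

section Limits

variable {α : Type*} [MeasurableSpace α] {μ : Measure α}

theorem integrable_mul_conj {f h : α → ℂ} (hf : MemLp f 2 μ) (hh : MemLp h 2 μ) :
    Integrable (fun x => h x * conj (f x)) μ :=
  MemLp.integrable_mul hh hf.star

/-- Continuity of the `L²` pairing in its second argument. -/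
theorem tendsto_integral_mul_conj {h v : α → ℂ} {f : ℕ → α → ℂ} (hh : MemLp h 2 μ)
    (hv : MemLp v 2 μ) (hf : ∀ n, MemLp (f n) 2 μ)
    (hlim : Tendsto (fun n => eLpNorm (fun x => v x - f n x) 2 μ) atTop (𝓝 0)) :
    Tendsto (fun n => ∫ x, h x * conj (f n x) ∂μ) atTop (𝓝 (∫ x, h x * conj (v x) ∂μ)) := by
  refine tendsto_integral_of_L1 _ (integrable_mul_conj hv hh).1
    (Eventually.of_forall fun n => integrable_mul_conj (hf n) hh) ?_
  have hbound : Tendsto (fun n => eLpNorm h 2 μ * eLpNorm (fun x => v x - f n x) 2 μ)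
      atTop (𝓝 0) := by
    simpa using ENNReal.Tendsto.const_mul hlim (Or.inr hh.2.ne)
  refine tendsto_of_tendsto_of_tendsto_of_le_of_le tendsto_const_nhds hbound
    (fun _ => zero_le) fun n => ?_
  have hd : MemLp (fun x => v x - f n x) 2 μ := hv.sub (hf n)
  calc ∫⁻ x, ‖h x * conj (f n x) - h x * conj (v x)‖ₑ ∂μ
      = eLpNorm (h • fun x => v x - f n x) 1 μ := by
        rw [eLpNorm_one_eq_lintegral_enorm]
        refine lintegral_congr fun x => ?_
        rw [← mul_sub, ← map_sub, enorm_mul, Pi.smul_apply', smul_eq_mul, enorm_mul,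
          enorm_sub_rev (v x), ← ofReal_norm (conj _), RCLike.norm_conj, ofReal_norm]
    _ ≤ _ := eLpNorm_smul_le_mul_eLpNorm hd.1 hh.1

/-- Boundedly and pointwise convergent scalar weights pass to the limit under an integral. -/
theorem tendsto_integral_real_mul {f : α → ℂ} (hf : Integrable f μ) {c : ℕ → α → ℝ} {C l : ℝ}
    (hcm : ∀ n, AEStronglyMeasurable (c n) μ) (hc : ∀ n x, |c n x| ≤ C)
    (hlim : ∀ x, Tendsto (fun n => c n x) atTop (𝓝 l)) :
    Tendsto (fun n => ∫ x, (c n x : ℂ) * f x ∂μ) atTop (𝓝 ((l : ℂ) * ∫ x, f x ∂μ)) := by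
  rw [← integral_const_mul]
  refine tendsto_integral_of_dominated_convergence (fun x => C * ‖f x‖)
    (fun n => (Complex.continuous_ofReal.comp_aestronglyMeasurable (hcm n)).mul hf.1)
    (hf.norm.const_mul C) (fun n => Eventually.of_forall fun x => ?_)
    (Eventually.of_forall fun x => ?_)
  · rw [norm_mul, Complex.norm_real]
    exact mul_le_mul_of_nonneg_right (hc n x) (norm_nonneg _)
  · exact ((Complex.continuous_ofReal.tendsto l).comp (hlim x)).mul_const _

end Limits

/-! ### Cutoff functions. -/

section Cutoff

/-- A sequence of smooth cutoff functions exhausting the space, with gradients tending to `0`. -/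
theorem exists_cutoff (N : ℕ) : ∃ (ξ : ℕ → EuclideanSpace ℝ (Fin N) → ℝ) (C : ℝ),
    (∀ n, ContDiff ℝ (⊤ : ℕ∞) (ξ n)) ∧ (∀ n, HasCompactSupport (ξ n)) ∧
    (∀ n x, |ξ n x| ≤ 1) ∧ (∀ x, Tendsto (fun n => ξ n x) atTop (𝓝 1)) ∧
    (∀ n x j, |fderiv ℝ (ξ n) x (EuclideanSpace.single j 1)| ≤ C) ∧
    ∀ x j, Tendsto (fun n => fderiv ℝ (ξ n) x (EuclideanSpace.single j 1)) atTop (𝓝 0) := by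
  let χ : ContDiffBump (0 : EuclideanSpace ℝ (Fin N)) := ⟨1, 2, one_pos, one_lt_two⟩
  have hχ : ContDiff ℝ (⊤ : ℕ∞) χ := χ.contDiff
  obtain ⟨C, hC⟩ := (hχ.continuous_fderiv (by simp)).bounded_above_of_compact_support
    (χ.hasCompactSupport.fderiv ℝ)
  have hC0 : 0 ≤ C := (norm_nonneg _).trans (hC 0)
  -- Dilating a fixed bump by `c n → 0` multiplies its gradient by `c n`, while each fixed point is
  -- eventually moved into the unit ball, where the bump equals `1`.
  let c : ℕ → ℝ := fun n => 1 / ((n : ℝ) + 1)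
  have hcpos : ∀ n, 0 < c n := fun n => Nat.one_div_pos_of_nat
  have hc1 : ∀ n, c n ≤ 1 := fun n => by
    rw [div_le_one (by positivity)]
    linarith [(n.cast_nonneg : (0 : ℝ) ≤ n)]
  have hclim : Tendsto c atTop (𝓝 0) := tendsto_one_div_add_atTop_nhds_zero_nat
  have hbound : ∀ n x j,
      |fderiv ℝ (fun y => χ (c n • y)) x (EuclideanSpace.single j 1)| ≤ c n * C := by
    intro n x j
    rw [fderiv_comp_smul (f := χ), ← Real.norm_eq_abs]
    refine (ContinuousLinearMap.le_opNorm _ _).trans ?_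
    rw [PiLp.norm_single, norm_one, mul_one, norm_smul, Real.norm_of_nonneg (hcpos n).le]
    exact mul_le_mul_of_nonneg_left (hC _) (hcpos n).le
  refine ⟨fun n x => χ (c n • x), C, fun n => hχ.comp (contDiff_const_smul _),
    fun n => χ.hasCompactSupport.comp_smul (hcpos n).ne', fun n x => ?_, fun x => ?_,
    fun n x j => (hbound n x j).trans (mul_le_of_le_one_left hC0 (hc1 n)), fun x j => ?_⟩
  · rw [abs_of_nonneg χ.nonneg]
    exact χ.le_one
  · have h1 : Tendsto (fun n => c n • x) atTop (𝓝 ((0 : ℝ) • x)) := hclim.smul_const x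
    have := (χ.continuous.tendsto _).comp h1
    rwa [zero_smul, χ.one_of_mem_closedBall (by simp [χ])] at this
  · refine squeeze_zero_norm (fun n => hbound n x j) ?_
    simpa using hclim.mul_const C

end Cutoff

/-! ### Operations on test functions. -/

section TestFunctions

variable {N : ℕ} {Ω : Opens (EuclideanSpace ℝ (Fin N))}

/-- The complex conjugate of a test function. -/
def conjTest (φ : 𝓓(Ω, ℂ)) : 𝓓(Ω, ℂ) where
  toFun x := conj (φ x)
  contDiff' := (RCLike.conjCLE (K := ℂ)).contDiff.comp φ.contDiff
  hasCompactSupport' := φ.hasCompactSupport.comp_left (map_zero _)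
  tsupport_subset' := (tsupport_comp_subset (map_zero _) φ).trans φ.tsupport_subset

/-- The product of a test function and a smooth real function. -/
def mulTest {ξ : EuclideanSpace ℝ (Fin N) → ℝ} (hξ : ContDiff ℝ (⊤ : ℕ∞) ξ) (φ : 𝓓(Ω, ℂ)) :
    𝓓(Ω, ℂ) where
  toFun x := (ξ x : ℂ) * φ x
  contDiff' := (Complex.ofRealCLM.contDiff.comp hξ).mul φ.contDiff
  hasCompactSupport' := φ.hasCompactSupport.mul_left
  tsupport_subset' := (tsupport_mul_subset_right).trans φ.tsupport_subset

/-- The partial derivative of a test function. -/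
def partialTest (j : Fin N) (φ : 𝓓(Ω, ℂ)) : 𝓓(Ω, ℂ) where
  toFun := partialDeriv j φ
  contDiff' := (φ.contDiff.fderiv_right (m := (⊤ : ℕ∞)) (by simp)).clm_apply contDiff_const
  hasCompactSupport' := φ.hasCompactSupport.fderiv_apply ℝ _
  tsupport_subset' := (tsupport_fderiv_apply_subset ℝ _).trans φ.tsupport_subset

@[simp]
theorem conjTest_apply (φ : 𝓓(Ω, ℂ)) (x : EuclideanSpace ℝ (Fin N)) :
    conjTest φ x = conj (φ x) := rfl

@[simp]
theorem mulTest_apply {ξ : EuclideanSpace ℝ (Fin N) → ℝ} (hξ : ContDiff ℝ (⊤ : ℕ∞) ξ)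
    (φ : 𝓓(Ω, ℂ)) (x : EuclideanSpace ℝ (Fin N)) : mulTest hξ φ x = (ξ x : ℂ) * φ x := rfl

@[simp]
theorem partialTest_apply (j : Fin N) (φ : 𝓓(Ω, ℂ)) (x : EuclideanSpace ℝ (Fin N)) :
    partialTest j φ x = partialDeriv j φ x := rfl

theorem differentiable_testFunction (φ : 𝓓(Ω, ℂ)) : Differentiable ℝ φ :=
  φ.contDiff.differentiable (by simp)

theorem partialDeriv_conjTest (j : Fin N) (φ : 𝓓(Ω, ℂ)) (x : EuclideanSpace ℝ (Fin N)) :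
    partialDeriv j (conjTest φ) x = conj (partialDeriv j φ x) := by
  have h := ((RCLike.conjCLE (K := ℂ)).toContinuousLinearMap.hasFDerivAt.comp x
    (differentiable_testFunction φ x).hasFDerivAt).fderiv
  have h' : fderiv ℝ (conjTest φ) x = _ := h
  unfold partialDeriv
  rw [h']
  rfl

theorem partialDeriv_mulTest (j : Fin N) {ξ : EuclideanSpace ℝ (Fin N) → ℝ}
    (hξ : ContDiff ℝ (⊤ : ℕ∞) ξ) (φ : 𝓓(Ω, ℂ)) (x : EuclideanSpace ℝ (Fin N)) :
    partialDeriv j (mulTest hξ φ) x =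
      ((fderiv ℝ ξ x (EuclideanSpace.single j 1) : ℝ) : ℂ) * φ x
        + (ξ x : ℂ) * partialDeriv j φ x := by
  have hξ' := Complex.ofRealCLM.hasFDerivAt.comp x
    ((hξ.differentiable (by simp)) x).hasFDerivAt
  have h : fderiv ℝ (mulTest hξ φ) x = _ :=
    (hξ'.mul (differentiable_testFunction φ x).hasFDerivAt).fderiv
  unfold partialDeriv
  rw [h]
  simp
  ring

theorem partialDeriv_smul (j : Fin N) (c : ℂ) (φ : 𝓓(Ω, ℂ)) (x : EuclideanSpace ℝ (Fin N)) :
    partialDeriv j (c • φ : 𝓓(Ω, ℂ)) x = c * partialDeriv j φ x := by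
  have h : fderiv ℝ (c • φ : 𝓓(Ω, ℂ)) x = _ :=
    ((differentiable_testFunction φ x).hasFDerivAt.const_smul c).fderiv
  unfold partialDeriv
  rw [h]
  rfl

theorem partialDeriv_sub (j : Fin N) (φ ψ : 𝓓(Ω, ℂ)) (x : EuclideanSpace ℝ (Fin N)) :
    partialDeriv j (φ - ψ : 𝓓(Ω, ℂ)) x = partialDeriv j φ x - partialDeriv j ψ x := by
  have h : fderiv ℝ (φ - ψ : 𝓓(Ω, ℂ)) x = _ :=
    ((differentiable_testFunction φ x).hasFDerivAt.sub
      (differentiable_testFunction ψ x).hasFDerivAt).fderiv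
  unfold partialDeriv
  rw [h]
  rfl

/-- Since each first derivative is again a test function, the definition of the weak gradient
applies to each summand. -/
theorem laplacian_testFunction (φ : 𝓓(Ω, ℂ)) (x : EuclideanSpace ℝ (Fin N)) :
    (Δ (φ : EuclideanSpace ℝ (Fin N) → ℂ)) x = ∑ j, partialDeriv j (partialTest j φ) x := by
  rw [InnerProductSpace.laplacian_eq_iteratedFDeriv_orthonormalBasis _
    (EuclideanSpace.basisFun (Fin N) ℝ)]
  refine Finset.sum_congr rfl fun j _ => ?_
  have hd : DifferentiableAt ℝ (fderiv ℝ φ) x :=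
    ((φ.contDiff.fderiv_right (m := (⊤ : ℕ∞)) (by simp)).differentiable (by simp)) x
  have h : fderiv ℝ (partialTest j φ) x = _ :=
    (hd.hasFDerivAt.clm_apply (hasFDerivAt_const (EuclideanSpace.single j (1 : ℝ)) x)).fderiv
  unfold partialDeriv
  rw [h, iteratedFDeriv_two_apply]
  simp

theorem memLp_testFunction (φ : 𝓓(Ω, ℂ)) (p : ℝ≥0∞) (μ : Measure (EuclideanSpace ℝ (Fin N)))
    [IsFiniteMeasureOnCompacts μ] : MemLp φ p μ :=
  φ.continuous.memLp_of_hasCompactSupport φ.hasCompactSupport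

theorem memLp_partialDeriv (j : Fin N) (φ : 𝓓(Ω, ℂ)) (p : ℝ≥0∞)
    (μ : Measure (EuclideanSpace ℝ (Fin N))) [IsFiniteMeasureOnCompacts μ] :
    MemLp (partialDeriv j φ) p μ :=
  memLp_testFunction (partialTest j φ) p μ

end TestFunctions

/-! ### Elements of `H¹_0` as limits of test functions. -/

variable {N : ℕ} {Ω : Opens (EuclideanSpace ℝ (Fin N))}

/-- `u`, with square integrable weak gradient `g`, is the `H¹(Ω)`-limit of the sequence `φ` of
test functions. -/
structure IsH1Limit (Ω : Opens (EuclideanSpace ℝ (Fin N))) (u : EuclideanSpace ℝ (Fin N) → ℂ)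
    (g : Fin N → EuclideanSpace ℝ (Fin N) → ℂ) (φ : ℕ → 𝓓(Ω, ℂ)) : Prop where
  memLp : MemLp u 2 (volume.restrict Ω)
  memLp_grad : ∀ j, MemLp (g j) 2 (volume.restrict Ω)
  integral_grad : ∀ j (ψ : 𝓓(Ω, ℂ)),
    ∫ x in (Ω : Set (EuclideanSpace ℝ (Fin N))), u x * partialDeriv j ψ x
      = - ∫ x in (Ω : Set (EuclideanSpace ℝ (Fin N))), g j x * ψ x
  tendsto : Tendsto (fun n => eLpNorm (fun x => u x - φ n x) 2 (volume.restrict Ω)) atTop (𝓝 0)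
  tendsto_grad : ∀ j, Tendsto
    (fun n => eLpNorm (fun x => g j x - partialDeriv j (φ n) x) 2 (volume.restrict Ω)) atTop (𝓝 0)

theorem eLpNorm_le_eH1Norm (u : EuclideanSpace ℝ (Fin N) → ℂ)
    (g : Fin N → EuclideanSpace ℝ (Fin N) → ℂ) :
    eLpNorm u 2 (volume.restrict Ω) ≤ eH1Norm Ω u g := by
  rw [eH1Norm, one_div, ENNReal.le_rpow_inv_iff two_pos, ENNReal.rpow_two]
  exact le_self_add

theorem eLpNorm_grad_le_eH1Norm (u : EuclideanSpace ℝ (Fin N) → ℂ)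
    (g : Fin N → EuclideanSpace ℝ (Fin N) → ℂ) (j : Fin N) :
    eLpNorm (g j) 2 (volume.restrict Ω) ≤ eH1Norm Ω u g := by
  rw [eH1Norm, one_div, ENNReal.le_rpow_inv_iff two_pos, ENNReal.rpow_two]
  exact (Finset.single_le_sum (f := fun j => eLpNorm (g j) 2 (volume.restrict Ω) ^ 2)
    (fun _ _ => zero_le) (Finset.mem_univ j)).trans le_add_self

theorem MemH10.exists_isH1Limit {u : EuclideanSpace ℝ (Fin N) → ℂ} (hu : MemH10 Ω u) :
    ∃ g φ, IsH1Limit Ω u g φ := by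
  obtain ⟨g, hg, hu2, hg2, happ⟩ := hu
  -- For `n = 0` the tolerance is `∞`, which is still positive.
  choose φ hφ using fun n : ℕ => happ ((n : ℝ≥0∞)⁻¹) (by simp)
  refine ⟨g, φ, hu2, hg2, fun j => (hg.2 j).2, ?_, fun j => ?_⟩
  · exact tendsto_of_tendsto_of_tendsto_of_le_of_le tendsto_const_nhds
      ENNReal.tendsto_inv_nat_nhds_zero (fun _ => zero_le)
      fun n => (eLpNorm_le_eH1Norm _ _).trans (hφ n).le
  · exact tendsto_of_tendsto_of_tendsto_of_le_of_le tendsto_const_nhds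
      ENNReal.tendsto_inv_nat_nhds_zero (fun _ => zero_le)
      fun n => (eLpNorm_grad_le_eH1Norm _ (fun j x => g j x - partialDeriv j (φ n) x) j).trans
        (hφ n).le

theorem integrable_mul_testFunction {f : EuclideanSpace ℝ (Fin N) → ℂ}
    (hf : MemLp f 2 (volume.restrict Ω)) (φ : 𝓓(Ω, ℂ)) :
    Integrable (fun x => f x * φ x) (volume.restrict Ω) :=
  MemLp.integrable_mul hf (memLp_testFunction φ 2 _)

theorem IsH1Limit.sub {u v : EuclideanSpace ℝ (Fin N) → ℂ}
    {g h : Fin N → EuclideanSpace ℝ (Fin N) → ℂ} {φ ψ : ℕ → 𝓓(Ω, ℂ)}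
    (hu : IsH1Limit Ω u g φ) (hv : IsH1Limit Ω v h ψ) :
    IsH1Limit Ω (fun x => u x - v x) (fun j x => g j x - h j x) (fun n => φ n - ψ n) where
  memLp := hu.memLp.sub hv.memLp
  memLp_grad j := (hu.memLp_grad j).sub (hv.memLp_grad j)
  integral_grad j χ := by
    have h1 := integrable_mul_testFunction hu.memLp (partialTest j χ)
    have h2 := integrable_mul_testFunction hv.memLp (partialTest j χ)
    have h3 := integrable_mul_testFunction (hu.memLp_grad j) χ
    have h4 := integrable_mul_testFunction (hv.memLp_grad j) χ
    simp only [partialTest_apply] at h1 h2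
    simp only [sub_mul]
    rw [integral_sub h1 h2, integral_sub h3 h4, hu.integral_grad, hv.integral_grad]
    ring
  tendsto := by
    have hlim := hu.tendsto.add hv.tendsto
    rw [add_zero] at hlim
    refine tendsto_of_tendsto_of_tendsto_of_le_of_le tendsto_const_nhds hlim (fun _ => zero_le)
      fun n => ?_
    have h1 := hu.memLp.1.sub (memLp_testFunction (φ n) 2 (volume.restrict Ω)).1
    have h2 := hv.memLp.1.sub (memLp_testFunction (ψ n) 2 (volume.restrict Ω)).1
    refine le_trans (le_of_eq ?_) (eLpNorm_sub_le h1 h2 one_le_two)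
    congr 1
    ext x
    have hx : (φ n - ψ n : 𝓓(Ω, ℂ)) x = φ n x - ψ n x := rfl
    simp only [Pi.sub_apply, hx]
    ring
  tendsto_grad j := by
    have hlim := (hu.tendsto_grad j).add (hv.tendsto_grad j)
    rw [add_zero] at hlim
    refine tendsto_of_tendsto_of_tendsto_of_le_of_le tendsto_const_nhds hlim (fun _ => zero_le)
      fun n => ?_
    have h1 := (hu.memLp_grad j).1.sub (memLp_partialDeriv j (φ n) 2 (volume.restrict Ω)).1
    have h2 := (hv.memLp_grad j).1.sub (memLp_partialDeriv j (ψ n) 2 (volume.restrict Ω)).1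
    refine le_trans (le_of_eq ?_) (eLpNorm_sub_le h1 h2 one_le_two)
    congr 1
    ext x
    simp only [Pi.sub_apply, partialDeriv_sub]
    ring

theorem memLp_real_mul {f : EuclideanSpace ℝ (Fin N) → ℂ} {μ : Measure (EuclideanSpace ℝ (Fin N))}
    (hf : MemLp f 2 μ) {c : EuclideanSpace ℝ (Fin N) → ℝ} (hc : Continuous c) {C : ℝ}
    (hC : ∀ x, |c x| ≤ C) : MemLp (fun x => (c x : ℂ) * f x) 2 μ := by
  refine MemLp.of_le_mul (c := C) hf
    ((Complex.continuous_ofReal.comp hc).aestronglyMeasurable.mul hf.1)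
    (Eventually.of_forall fun x => ?_)
  rw [norm_mul, Complex.norm_real]
  exact mul_le_mul_of_nonneg_right (hC x) (norm_nonneg _)

theorem continuous_fderiv_single {ξ : EuclideanSpace ℝ (Fin N) → ℝ}
    (hξ : ContDiff ℝ (⊤ : ℕ∞) ξ) (j : Fin N) :
    Continuous fun x => fderiv ℝ ξ x (EuclideanSpace.single j 1) :=
  (hξ.continuous_fderiv (by simp)).clm_apply continuous_const

/-! ### Testing against the limit function. -/

section Limit

variable {u : EuclideanSpace ℝ (Fin N) → ℂ} {g : Fin N → EuclideanSpace ℝ (Fin N) → ℂ}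
  {φ : ℕ → 𝓓(Ω, ℂ)}

theorem IsH1Limit.tendsto_integral (hu : IsH1Limit Ω u g φ) {h : EuclideanSpace ℝ (Fin N) → ℂ}
    (hh : MemLp h 2 (volume.restrict Ω)) :
    Tendsto (fun n => ∫ x in (Ω : Set (EuclideanSpace ℝ (Fin N))), h x * conj (φ n x)) atTop
      (𝓝 (∫ x in (Ω : Set (EuclideanSpace ℝ (Fin N))), h x * conj (u x))) :=
  tendsto_integral_mul_conj hh hu.memLp (fun n => memLp_testFunction (φ n) 2 _) hu.tendsto

theorem IsH1Limit.tendsto_integral_grad (hu : IsH1Limit Ω u g φ)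
    {h : EuclideanSpace ℝ (Fin N) → ℂ} (hh : MemLp h 2 (volume.restrict Ω)) (j : Fin N) :
    Tendsto (fun n => ∫ x in (Ω : Set (EuclideanSpace ℝ (Fin N))),
      h x * conj (partialDeriv j (φ n) x)) atTop
      (𝓝 (∫ x in (Ω : Set (EuclideanSpace ℝ (Fin N))), h x * conj (g j x))) :=
  tendsto_integral_mul_conj hh (hu.memLp_grad j) (fun n => memLp_partialDeriv j (φ n) 2 _)
    (hu.tendsto_grad j)

/-- A function in `H¹_0(Ω)` with a vanishing partial derivative vanishes. -/
theorem IsH1Limit.ae_eq_zero_of_grad_ae_eq_zero (hu : IsH1Limit Ω u g φ) {j : Fin N}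
    (hg : g j =ᵐ[volume.restrict Ω] 0) : u =ᵐ[volume.restrict Ω] 0 := by
  -- Poincaré's inequality may fail on an unbounded domain. The weight `arctan (x j)` replaces it:
  -- it is bounded and so is its derivative in direction `j`, which is positive everywhere.
  let η : EuclideanSpace ℝ (Fin N) → ℝ := fun x => Real.arctan (x j)
  have hη : ContDiff ℝ (⊤ : ℕ∞) η :=
    Real.contDiff_arctan.comp (EuclideanSpace.proj (𝕜 := ℝ) j).contDiff
  have hη' : ∀ x, fderiv ℝ η x (EuclideanSpace.single j 1) = 1 / (1 + x j ^ 2) := fun x => by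
    have h1 : HasFDerivAt η _ x :=
      ((EuclideanSpace.proj (𝕜 := ℝ) j).hasFDerivAt (x := x)).arctan
    rw [h1.fderiv]
    simp
  have hηb : ∀ x, |η x| ≤ Real.pi / 2 := fun x =>
    abs_le.2 ⟨(Real.neg_pi_div_two_lt_arctan _).le, (Real.arctan_lt_pi_div_two _).le⟩
  have hη'b : ∀ x, |fderiv ℝ η x (EuclideanSpace.single j 1)| ≤ 1 := fun x => by
    rw [hη', abs_of_pos (by positivity), div_le_one (by positivity)]
    linarith [sq_nonneg (x j)]
  have hm1 := memLp_real_mul hu.memLp (continuous_fderiv_single hη j) hη'b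
  have hm2 := memLp_real_mul hu.memLp hη.continuous hηb
  -- Since `g j = 0`, testing the weak derivative of `u` with `η` times the conjugate of `φ n` gives
  -- zero. In the limit only `∫ ∂_jη |u|²` survives.
  have hzero : ∀ n, (∫ x in (Ω : Set (EuclideanSpace ℝ (Fin N))),
        ((fderiv ℝ η x (EuclideanSpace.single j 1) : ℝ) : ℂ) * u x * conj (φ n x))
      + ∫ x in (Ω : Set (EuclideanSpace ℝ (Fin N))),
        ((η x : ℂ) * u x) * conj (partialDeriv j (φ n) x) = 0 := fun n => by
    rw [← integral_add (integrable_mul_conj (memLp_testFunction (φ n) 2 _) hm1)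
      (integrable_mul_conj (memLp_partialDeriv j (φ n) 2 _) hm2)]
    have h0 : ∫ x in (Ω : Set (EuclideanSpace ℝ (Fin N))),
        g j x * mulTest hη (conjTest (φ n)) x = 0 := by
      refine integral_eq_zero_of_ae ?_
      filter_upwards [hg] with x hx
      simp [hx]
    have h := hu.integral_grad j (mulTest hη (conjTest (φ n)))
    rw [h0, neg_zero] at h
    rw [← h]
    refine integral_congr_ae (Eventually.of_forall fun x => ?_)
    simp only [partialDeriv_mulTest, partialDeriv_conjTest, conjTest_apply]
    ring
  have hlim := (hu.tendsto_integral hm1).add (hu.tendsto_integral_grad hm2 j)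
  simp only [hzero] at hlim
  have h0 : ∫ x in (Ω : Set (EuclideanSpace ℝ (Fin N))), ((η x : ℂ) * u x) * conj (g j x) = 0 := by
    refine integral_eq_zero_of_ae ?_
    filter_upwards [hg] with x hx
    simp [hx]
  have hint := tendsto_nhds_unique tendsto_const_nhds hlim
  rw [h0, add_zero] at hint
  have hcongr : ∀ x, ((fderiv ℝ η x (EuclideanSpace.single j 1) : ℝ) : ℂ) * u x * conj (u x)
      = ((1 / (1 + x j ^ 2) * ‖u x‖ ^ 2 : ℝ) : ℂ) := fun x => by
    rw [hη', mul_assoc, Complex.mul_conj, Complex.normSq_eq_norm_sq, Complex.ofReal_mul]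
  have hI := integrable_mul_conj hu.memLp hm1
  simp only [hcongr] at hint hI
  rw [integral_complex_ofReal] at hint
  have hI' : Integrable (fun x => 1 / (1 + x j ^ 2) * ‖u x‖ ^ 2) (volume.restrict Ω) := by
    simpa only [RCLike.re_to_complex, Complex.ofReal_re] using hI.re
  have := (integral_eq_zero_iff_of_nonneg (fun x => by positivity) hI').1
    (Complex.ofReal_eq_zero.1 hint.symm)
  filter_upwards [this] with x hx
  have hpos : (1 / (1 + x j ^ 2)) ≠ 0 := by positivity
  simpa only [Pi.zero_apply, mul_eq_zero, hpos, false_or, sq_eq_zero_iff, norm_eq_zero] using hx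

/-- The weak equation `-iΔu + H = 0`, tested with test functions, may be tested with `ξ u` for
a smooth compactly supported real function `ξ`. -/
theorem IsH1Limit.weak_form_cutoff (hu : IsH1Limit Ω u g φ) {H : EuclideanSpace ℝ (Fin N) → ℂ}
    (heq : ∀ ψ : 𝓓(Ω, ℂ), Complex.I * ∑ j, (∫ x in (Ω : Set (EuclideanSpace ℝ (Fin N))),
      g j x * conj (partialDeriv j ψ x))
        + ∫ x in (Ω : Set (EuclideanSpace ℝ (Fin N))), H x * conj (ψ x) = 0)
    {ξ : EuclideanSpace ℝ (Fin N) → ℝ} (hξ : ContDiff ℝ (⊤ : ℕ∞) ξ) {C C' : ℝ}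
    (hC : ∀ x, |ξ x| ≤ C) (hC' : ∀ x j, |fderiv ℝ ξ x (EuclideanSpace.single j 1)| ≤ C')
    (hH : MemLp (fun x => (ξ x : ℂ) * H x) 2 (volume.restrict Ω)) :
    Complex.I * ∑ j, ((∫ x in (Ω : Set (EuclideanSpace ℝ (Fin N))),
          ((fderiv ℝ ξ x (EuclideanSpace.single j 1) : ℝ) : ℂ) * (g j x * conj (u x)))
        + ∫ x in (Ω : Set (EuclideanSpace ℝ (Fin N))), (ξ x : ℂ) * (g j x * conj (g j x)))
      + ∫ x in (Ω : Set (EuclideanSpace ℝ (Fin N))), (ξ x : ℂ) * (H x * conj (u x)) = 0 := by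
  have hm1 : ∀ j, _ := fun j =>
    memLp_real_mul (hu.memLp_grad j) (continuous_fderiv_single hξ j) (hC' · j)
  have hm2 : ∀ j, _ := fun j => memLp_real_mul (hu.memLp_grad j) hξ.continuous hC
  -- The test function is `ξ φ n`. Attaching `ξ` and its derivatives to `g` and `H` leaves fixed
  -- `L²` functions paired with `φ n` and its derivatives, so convergence in `H¹` is enough.
  have hlim := ((tendsto_finsetSum Finset.univ fun j _ =>
    (hu.tendsto_integral (hm1 j)).add (hu.tendsto_integral_grad (hm2 j) j)).const_mul
      Complex.I).add (hu.tendsto_integral hH)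
  have hzero : ∀ n, Complex.I * ∑ j, ((∫ x in (Ω : Set (EuclideanSpace ℝ (Fin N))),
          ((fderiv ℝ ξ x (EuclideanSpace.single j 1) : ℝ) : ℂ) * g j x * conj (φ n x))
        + ∫ x in (Ω : Set (EuclideanSpace ℝ (Fin N))),
          (ξ x : ℂ) * g j x * conj (partialDeriv j (φ n) x))
      + ∫ x in (Ω : Set (EuclideanSpace ℝ (Fin N))), (ξ x : ℂ) * H x * conj (φ n x) = 0 := by
    intro n
    rw [← heq (mulTest hξ (φ n))]
    congr 1
    · congr 1
      refine Finset.sum_congr rfl fun j _ => ?_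
      rw [← integral_add (integrable_mul_conj (memLp_testFunction (φ n) 2 _) (hm1 j))
        (integrable_mul_conj (memLp_partialDeriv j (φ n) 2 _) (hm2 j))]
      refine integral_congr_ae (Eventually.of_forall fun x => ?_)
      simp only [partialDeriv_mulTest, map_add, map_mul, Complex.conj_ofReal]
      ring
    · refine integral_congr_ae (Eventually.of_forall fun x => ?_)
      simp only [mulTest_apply, map_mul, Complex.conj_ofReal]
      ring
  simp only [hzero] at hlim
  simpa only [mul_assoc] using (tendsto_nhds_unique tendsto_const_nhds hlim).symm

/-- The weak equation `-iΔu + H = 0` may be tested with `u` itself as soon as `H ū` is integrable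
and `H` is locally square integrable up to the boundary. -/
theorem IsH1Limit.energy_identity (hu : IsH1Limit Ω u g φ) {H : EuclideanSpace ℝ (Fin N) → ℂ}
    (heq : ∀ ψ : 𝓓(Ω, ℂ), Complex.I * ∑ j, (∫ x in (Ω : Set (EuclideanSpace ℝ (Fin N))),
      g j x * conj (partialDeriv j ψ x))
        + ∫ x in (Ω : Set (EuclideanSpace ℝ (Fin N))), H x * conj (ψ x) = 0)
    (hH : ∀ ξ : EuclideanSpace ℝ (Fin N) → ℝ, Continuous ξ → HasCompactSupport ξ →
      MemLp (fun x => (ξ x : ℂ) * H x) 2 (volume.restrict Ω))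
    (hHu : Integrable (fun x => H x * conj (u x)) (volume.restrict Ω)) :
    Complex.I * ∑ j, (∫ x in (Ω : Set (EuclideanSpace ℝ (Fin N))), g j x * conj (g j x))
      + ∫ x in (Ω : Set (EuclideanSpace ℝ (Fin N))), H x * conj (u x) = 0 := by
  obtain ⟨ξ, C, hξ, hξs, hξ1, hξlim, hξ', hξ'lim⟩ := exists_cutoff N
  have hcut := fun n => hu.weak_form_cutoff heq (hξ n) (hξ1 n) (hξ' n)
    (hH (ξ n) (hξ n).continuous (hξs n))
  -- As the cutoffs exhaust the space, the terms carrying their derivatives tend to `0` and the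
  -- others to the full integrals.
  have hlim := ((tendsto_finsetSum Finset.univ fun j _ =>
    (tendsto_integral_real_mul (integrable_mul_conj hu.memLp (hu.memLp_grad j))
      (fun n => (continuous_fderiv_single (hξ n) j).aestronglyMeasurable)
      (fun n x => hξ' n x j) (fun x => hξ'lim x j)).add
    (tendsto_integral_real_mul (integrable_mul_conj (hu.memLp_grad j) (hu.memLp_grad j))
      (fun n => (hξ n).continuous.aestronglyMeasurable) hξ1 hξlim)).const_mul Complex.I).add
    (tendsto_integral_real_mul hHu (fun n => (hξ n).continuous.aestronglyMeasurable) hξ1 hξlim)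
  simp only [hcut] at hlim
  simpa using (tendsto_nhds_unique tendsto_const_nhds hlim).symm

end Limit

/-! ### The equation for the difference of two solutions. -/

theorem IsH1Limit.integral_mul_conj_laplacian {u : EuclideanSpace ℝ (Fin N) → ℂ}
    {g : Fin N → EuclideanSpace ℝ (Fin N) → ℂ} {φ : ℕ → 𝓓(Ω, ℂ)} (hu : IsH1Limit Ω u g φ)
    (ψ : 𝓓(Ω, ℂ)) :
    ∫ x in (Ω : Set (EuclideanSpace ℝ (Fin N))),
        u x * conj ((Δ (ψ : EuclideanSpace ℝ (Fin N) → ℂ)) x)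
      = - ∑ j, ∫ x in (Ω : Set (EuclideanSpace ℝ (Fin N))),
          g j x * conj (partialDeriv j ψ x) := by
  simp only [laplacian_testFunction, map_sum, Finset.mul_sum]
  rw [integral_finsetSum _ fun j _ =>
      integrable_mul_conj (memLp_partialDeriv j (partialTest j ψ) 2 _) hu.memLp,
    ← Finset.sum_neg_distrib]
  refine Finset.sum_congr rfl fun j _ => ?_
  simpa only [partialDeriv_conjTest, conjTest_apply, partialTest_apply] using
    hu.integral_grad j (conjTest (partialTest j ψ))

theorem aestronglyMeasurable_nonlinearity (m : ℝ) {u : EuclideanSpace ℝ (Fin N) → ℂ}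
    {μ : Measure (EuclideanSpace ℝ (Fin N))} (hu : AEStronglyMeasurable u μ) :
    AEStronglyMeasurable (fun x => nonlinearity m (u x)) μ :=
  ((measurable_nonlinearity m).comp_aemeasurable hu.aemeasurable).aestronglyMeasurable

/-- The nonlinearity of a square integrable function is locally square integrable, up to the
boundary. -/
theorem memLp_mul_nonlinearity {m : ℝ} (hm0 : 0 < m) (hm1 : m < 1)
    {u : EuclideanSpace ℝ (Fin N) → ℂ} {μ : Measure (EuclideanSpace ℝ (Fin N))}
    [IsFiniteMeasureOnCompacts μ] (hu : MemLp u 2 μ) {ξ : EuclideanSpace ℝ (Fin N) → ℝ}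
    (hξ : Continuous ξ) (hξs : HasCompactSupport ξ) :
    MemLp (fun x => (ξ x : ℂ) * nonlinearity m (u x)) 2 μ := by
  obtain ⟨C, hC⟩ := hξ.bounded_above_of_compact_support hξs
  have h1 : MemLp ξ 2 μ := hξ.memLp_of_hasCompactSupport hξs
  have h2 := memLp_real_mul hu hξ hC
  refine MemLp.mono' (h1.norm.add h2.norm)
    ((Complex.continuous_ofReal.comp hξ).aestronglyMeasurable.mul
      (aestronglyMeasurable_nonlinearity m hu.1)) (Eventually.of_forall fun x => ?_)
  simp only [Pi.add_apply, norm_mul, Complex.norm_real]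
  nlinarith [norm_nonlinearity_le hm0 hm1 (u x), norm_nonneg (ξ x)]

theorem integrable_nonlinearity_mul_conj {m : ℝ} (hm0 : 0 < m) (hm1 : m < 1)
    {u : EuclideanSpace ℝ (Fin N) → ℂ} (hu : MemLp u 2 (volume.restrict Ω)) (ψ : 𝓓(Ω, ℂ)) :
    Integrable (fun x => nonlinearity m (u x) * conj (ψ x)) (volume.restrict Ω) := by
  have h1 : Integrable ψ (volume.restrict Ω) :=
    memLp_one_iff_integrable.1 (memLp_testFunction ψ 1 _)
  have h2 := integrable_mul_conj (memLp_testFunction ψ 2 _) hu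
  refine Integrable.mono' (h1.norm.add h2.norm)
    ((aestronglyMeasurable_nonlinearity m hu.1).mul (memLp_testFunction ψ 2 _).star.1)
    (Eventually.of_forall fun x => ?_)
  simp only [Pi.add_apply, norm_mul, RCLike.norm_conj]
  nlinarith [norm_nonlinearity_le hm0 hm1 (u x), norm_nonneg (ψ x)]

/-- This is where membership in `L^{m+1}` enters: square integrability does not suffice on a domain
of infinite measure. -/
theorem integrable_nonlinearity_sub_mul_conj {m : ℝ} (hm0 : 0 < m)
    {u v : EuclideanSpace ℝ (Fin N) → ℂ} {μ : Measure (EuclideanSpace ℝ (Fin N))}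
    (hu : MemLp u (ENNReal.ofReal (m + 1)) μ) (hv : MemLp v (ENNReal.ofReal (m + 1)) μ) :
    Integrable (fun x => (nonlinearity m (u x) - nonlinearity m (v x)) * conj (u x - v x)) μ := by
  have hp : ENNReal.ofReal (m + 1) ≠ 0 := by
    simp only [ne_eq, ENNReal.ofReal_eq_zero, not_le]
    linarith
  have h1 := hu.integrable_norm_rpow hp ENNReal.ofReal_ne_top
  have h2 := hv.integrable_norm_rpow hp ENNReal.ofReal_ne_top
  rw [ENNReal.toReal_ofReal (by linarith)] at h1 h2
  refine Integrable.mono' ((h1.add h2).const_mul 4)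
    (((aestronglyMeasurable_nonlinearity m hu.1).sub
      (aestronglyMeasurable_nonlinearity m hv.1)).mul
        (Complex.continuous_conj.comp_aestronglyMeasurable (hu.1.sub hv.1)))
    (Eventually.of_forall fun x => norm_nonlinearity_sub_mul_le hm0 (u x) (v x))

/-- The complex weak form of the equation satisfied by the difference of two solutions. -/
theorem weak_form_sub {m : ℝ} (hm0 : 0 < m) (hm1 : m < 1) {a b : ℂ}
    {F u v : EuclideanSpace ℝ (Fin N) → ℂ} {g h : Fin N → EuclideanSpace ℝ (Fin N) → ℂ}
    {φ χ : ℕ → 𝓓(Ω, ℂ)} (hu : IsH1Limit Ω u g φ) (hv : IsH1Limit Ω v h χ)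
    (hsu : IsLocalWeakSolution Ω m a b F u) (hsv : IsLocalWeakSolution Ω m a b F v)
    (ψ : 𝓓(Ω, ℂ)) :
    Complex.I * ∑ j, (∫ x in (Ω : Set (EuclideanSpace ℝ (Fin N))),
        (g j x - h j x) * conj (partialDeriv j ψ x))
      + ∫ x in (Ω : Set (EuclideanSpace ℝ (Fin N))),
        (a * (nonlinearity m (u x) - nonlinearity m (v x)) + b * (u x - v x)) * conj (ψ x)
      = 0 := by
  -- The definition of a solution controls real parts only. Subtracting the two equations cancels
  -- `F`, and one integration by parts turns `-i` into `+i`.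
  have hre : ∀ ψ : 𝓓(Ω, ℂ), (Complex.I * ∑ j, (∫ x in (Ω : Set (EuclideanSpace ℝ (Fin N))),
        (g j x - h j x) * conj (partialDeriv j ψ x))
      + ∫ x in (Ω : Set (EuclideanSpace ℝ (Fin N))),
        (a * (nonlinearity m (u x) - nonlinearity m (v x)) + b * (u x - v x)) * conj (ψ x)).re
      = 0 := by
    intro ψ
    have hint : ∀ w : EuclideanSpace ℝ (Fin N) → ℂ, MemLp w 2 (volume.restrict Ω) →
        Integrable (fun x => (a * nonlinearity m (w x) + b * w x) * conj (ψ x))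
          (volume.restrict Ω) := fun w hw => by
      have h1 := ((integrable_nonlinearity_mul_conj hm0 hm1 hw ψ).const_mul a).add
        ((integrable_mul_conj (memLp_testFunction ψ 2 _) hw).const_mul b)
      refine h1.congr (Eventually.of_forall fun x => ?_)
      simp only [Pi.add_apply]
      ring
    have hlap : ∀ w : EuclideanSpace ℝ (Fin N) → ℂ,
        ∫ x in (Ω : Set (EuclideanSpace ℝ (Fin N))),
          (-Complex.I * w x) * conj ((Δ (ψ : EuclideanSpace ℝ (Fin N) → ℂ)) x) =
        -Complex.I * ∫ x in (Ω : Set (EuclideanSpace ℝ (Fin N))),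
          w x * conj ((Δ (ψ : EuclideanSpace ℝ (Fin N) → ℂ)) x) := fun w => by
      rw [← integral_const_mul]
      simp only [mul_assoc]
    have hH : ∫ x in (Ω : Set (EuclideanSpace ℝ (Fin N))),
        (a * (nonlinearity m (u x) - nonlinearity m (v x)) + b * (u x - v x)) * conj (ψ x) =
        (∫ x in (Ω : Set (EuclideanSpace ℝ (Fin N))),
          (a * nonlinearity m (u x) + b * u x) * conj (ψ x)) -
        ∫ x in (Ω : Set (EuclideanSpace ℝ (Fin N))),
          (a * nonlinearity m (v x) + b * v x) * conj (ψ x) := by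
      rw [← integral_sub (hint u hu.memLp) (hint v hv.memLp)]
      refine integral_congr_ae (Eventually.of_forall fun x => ?_)
      ring
    have hlu := hu.integral_mul_conj_laplacian ψ
    have hlv := hv.integral_mul_conj_laplacian ψ
    have e := (hsu.2 ψ).trans (hsv.2 ψ).symm
    simp only [pairing, hlap, hlu, hlv] at e
    have hs : ∑ j, (∫ x in (Ω : Set (EuclideanSpace ℝ (Fin N))),
        (g j x - h j x) * conj (partialDeriv j ψ x)) =
        (∑ j, ∫ x in (Ω : Set (EuclideanSpace ℝ (Fin N))), g j x * conj (partialDeriv j ψ x)) -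
        ∑ j, ∫ x in (Ω : Set (EuclideanSpace ℝ (Fin N))), h j x * conj (partialDeriv j ψ x) := by
      rw [← Finset.sum_sub_distrib]
      refine Finset.sum_congr rfl fun j _ => ?_
      rw [← integral_sub (integrable_mul_conj (memLp_partialDeriv j ψ 2 _) (hu.memLp_grad j))
        (integrable_mul_conj (memLp_partialDeriv j ψ 2 _) (hv.memLp_grad j))]
      simp only [sub_mul]
    rw [hs, hH]
    simp only [Complex.add_re, Complex.sub_re, mul_sub, neg_mul, mul_neg, neg_neg] at e ⊢
    linarith
  refine Complex.ext (hre ψ) ?_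
  -- Replacing `ψ` by `iψ` multiplies the antilinear expression by `-i`, whose real part is then the
  -- original imaginary part.
  have hI := hre (Complex.I • ψ)
  have hψ : ∀ x, (Complex.I • ψ : 𝓓(Ω, ℂ)) x = Complex.I * ψ x := fun _ => rfl
  simp only [partialDeriv_smul, hψ, map_mul, Complex.conj_I, mul_left_comm _ (-Complex.I),
    integral_const_mul, ← Finset.mul_sum] at hI
  rw [← mul_add] at hI
  simpa using hI

end SublinearSchrodinger

end

/-! ### The uniqueness theorem. -/

theorem theorem5p2 {N : ℕ} (hN : 1 ≤ N)
    (Ω : Opens (EuclideanSpace ℝ (Fin N)))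
    (hΩ : (Ω : Set (EuclideanSpace ℝ (Fin N))).Nonempty)
    {m : ℝ} (hm0 : 0 < m) (hm1 : m < 1) (a b : ℂ)
    (hab : SublinearSchrodinger.UniquenessAssumption a b)
    (F : EuclideanSpace ℝ (Fin N) → ℂ) (hF : LocallyIntegrableOn F Ω volume)
    (u₁ u₂ : EuclideanSpace ℝ (Fin N) → ℂ)
    (h₁ : SublinearSchrodinger.IsGlobalWeakSolution Ω m a b F u₁)
    (h₂ : SublinearSchrodinger.IsGlobalWeakSolution Ω m a b F u₂) :
    u₁ =ᵐ[volume.restrict (Ω : Set (EuclideanSpace ℝ (Fin N)))] u₂ := by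
  open SublinearSchrodinger ComplexConjugate Filter in
  obtain ⟨g₁, φ₁, hl₁⟩ := h₁.2.1.exists_isH1Limit
  obtain ⟨g₂, φ₂, hl₂⟩ := h₂.2.1.exists_isH1Limit
  have hu := hl₁.sub hl₂
  have hG := integrable_nonlinearity_sub_mul_conj hm0 h₁.2.2 h₂.2.2
  have hB := integrable_mul_conj hu.memLp hu.memLp
  have hsplit : ∀ x, (a * (nonlinearity m (u₁ x) - nonlinearity m (u₂ x)) + b * (u₁ x - u₂ x))
        * conj (u₁ x - u₂ x) =
      a * ((nonlinearity m (u₁ x) - nonlinearity m (u₂ x)) * conj (u₁ x - u₂ x))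
        + b * ((u₁ x - u₂ x) * conj (u₁ x - u₂ x)) := fun x => by ring
  have henergy := hu.energy_identity (weak_form_sub hm0 hm1 hl₁ hl₂ h₁.1 h₂.1)
    (fun ξ hξ hξs => by
      obtain ⟨C, hC⟩ := hξ.bounded_above_of_compact_support hξs
      have h := (((memLp_mul_nonlinearity hm0 hm1 hl₁.memLp hξ hξs).sub
        (memLp_mul_nonlinearity hm0 hm1 hl₂.memLp hξ hξs)).const_mul a).add
        ((memLp_real_mul hu.memLp hξ hC).const_mul b)
      refine h.ae_eq (Eventually.of_forall fun x => ?_)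
      simp only [Pi.add_apply, Pi.sub_apply]
      ring)
    (by
      simp only [hsplit]
      exact (hG.const_mul a).add (hB.const_mul b))
  simp only [hsplit] at henergy
  rw [integral_add (hG.const_mul a) (hB.const_mul b), integral_const_mul, integral_const_mul]
    at henergy
  have hreal : ∀ w : EuclideanSpace ℝ (Fin N) → ℂ, ∫ x in (Ω : Set _), w x * conj (w x) =
      ((∫ x in (Ω : Set (EuclideanSpace ℝ (Fin N))), ‖w x‖ ^ 2 : ℝ) : ℂ) := fun w => by
    rw [← integral_complex_ofReal]
    refine integral_congr_ae (Eventually.of_forall fun x => ?_)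
    simp only [Complex.mul_conj, Complex.normSq_eq_norm_sq]
  simp only [hreal, ← Complex.ofReal_sum] at henergy
  set A : ℝ := ∑ j, ∫ x in (Ω : Set (EuclideanSpace ℝ (Fin N))), ‖g₁ j x - g₂ j x‖ ^ 2
  set B : ℝ := ∫ x in (Ω : Set (EuclideanSpace ℝ (Fin N))), ‖u₁ x - u₂ x‖ ^ 2 with hBdef
  have hgint : ∀ j, 0 ≤ ∫ x in (Ω : Set (EuclideanSpace ℝ (Fin N))), ‖g₁ j x - g₂ j x‖ ^ 2 :=
    fun j => integral_nonneg fun x => by positivity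
  have hA0 : 0 ≤ A := Finset.sum_nonneg fun j _ => hgint j
  have hB0 : 0 ≤ B := integral_nonneg fun x => by positivity
  have hsub : (fun x => u₁ x - u₂ x) =ᵐ[volume.restrict (Ω : Set (EuclideanSpace ℝ (Fin N)))] 0 →
      u₁ =ᵐ[volume.restrict (Ω : Set (EuclideanSpace ℝ (Fin N)))] u₂ := fun h => by
    filter_upwards [h] with x hx using sub_eq_zero.1 hx
  obtain ⟨haim, ⟨ha, hre⟩ | ⟨rfl, hb⟩⟩ := hab
  · have hpos : ∀ x, 0 ≤ ((nonlinearity m (u₁ x) - nonlinearity m (u₂ x))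
        * conj (u₁ x - u₂ x)).re := fun x => by
      by_cases hx : u₁ x = u₂ x
      · simp [hx]
      · exact (re_nonlinearity_sub_mul_conj_pos hm0 hx).le
    have hGre : (∫ x in (Ω : Set (EuclideanSpace ℝ (Fin N))),
        (nonlinearity m (u₁ x) - nonlinearity m (u₂ x)) * conj (u₁ x - u₂ x)).re =
        ∫ x in (Ω : Set (EuclideanSpace ℝ (Fin N))),
          ((nonlinearity m (u₁ x) - nonlinearity m (u₂ x)) * conj (u₁ x - u₂ x)).re :=
      (integral_re hG).symm
    set P := ∫ x in (Ω : Set (EuclideanSpace ℝ (Fin N))),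
        (nonlinearity m (u₁ x) - nonlinearity m (u₂ x)) * conj (u₁ x - u₂ x)
    have hmul := congrArg (fun z => (conj a * z).re) henergy
    -- Multiplying by `conj a` turns the coefficient of the sign-definite `P.re` into `|a|²` and
    -- removes the uncontrolled `P.im`; the other two coefficients are nonnegative by assumption.
    have hkey : a.im * A + Complex.normSq a * P.re + (a * conj b).re * B = 0 := by
      simp only [Complex.mul_re, Complex.mul_im, Complex.add_re, Complex.add_im, Complex.conj_re,
        Complex.conj_im, Complex.I_re, Complex.I_im, Complex.ofReal_re, Complex.ofReal_im,
        Complex.zero_re, Complex.zero_im, Complex.normSq_apply] at hmul ⊢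
      linear_combination hmul
    have hP0 : 0 ≤ P.re := by
      rw [hGre]
      exact integral_nonneg hpos
    have hna : 0 < Complex.normSq a := Complex.normSq_pos.2 ha
    have hP : P.re = 0 := by
      have h1 := mul_nonneg haim hA0
      have h2 := mul_nonneg hre hB0
      have h3 := mul_nonneg hna.le hP0
      have h4 : Complex.normSq a * P.re = 0 := by linarith
      exact (mul_eq_zero.1 h4).resolve_left hna.ne'
    rw [hGre] at hP
    filter_upwards [(integral_eq_zero_iff_of_nonneg hpos hG.re).1 hP] with x hx
    by_contra hne
    exact (re_nonlinearity_sub_mul_conj_pos hm0 hne).ne' hx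
  · simp only [zero_mul, zero_add] at henergy
    have him : A + b.im * B = 0 := by simpa using congrArg Complex.im henergy
    have hrB : b.re * B = 0 := by simpa using congrArg Complex.re henergy
    by_cases hB1 : B = 0
    · refine hsub ?_
      filter_upwards [(integral_eq_zero_iff_of_nonneg (fun x => by positivity)
        hu.memLp.norm.integrable_sq).1 hB1] with x hx
      simpa using hx
    · have hBpos : 0 < B := lt_of_le_of_ne hB0 (Ne.symm hB1)
      rcases hb with hb | rfl
      -- With `B > 0`, the real part gives `Re b = 0`, and `Im b > 0` would make `A + Im(b) B`
      -- positive. So `b` lies on the excluded half-line.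
      · refine absurd ⟨(mul_eq_zero.1 hrB).resolve_right hB1, ?_⟩ hb
        by_contra! hlt
        linarith [mul_pos hlt hBpos]
      · have hA : A = 0 := by simpa using him
        -- One direction suffices for the vanishing lemma, and `N ≥ 1` provides it.
        let j : Fin N := ⟨0, hN⟩
        have hj := (Finset.sum_eq_zero_iff_of_nonneg fun j _ => hgint j).1 hA j
          (Finset.mem_univ j)
        refine hsub (hu.ae_eq_zero_of_grad_ae_eq_zero (j := j) ?_)
        filter_upwards [(integral_eq_zero_iff_of_nonneg (fun x => by positivity)
          (hu.memLp_grad j).norm.integrable_sq).1 hj] with x hx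
        simpa using hx
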